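/- Let $(K,\nu)$ be a henselian valued field (Krull valuation $\nu$, written additively) with $\operatorname{char}K=p>0$, valuation ring $\mathcal O_K$ and residue field $K\nu$. Fix an algebraic closure $K^{\mathrm{ac}}$ of $K$, with the unique extension of $\nu$ to it. An algebraic extension $L|K$ inside $K^{\mathrm{ac}}$ is called purely wild if $\nu L/\nu K$ is a $p$-group and the residue field extension $L\nu|K\nu$ is purely inseparable. It is a minimal purely wild extension if it is purely wild and has no subextension other than $K$ and $L$; it is a maximal purely wild extension if it is purely wild and not properly contained in another purely wild extension of $K$ inside $K^{\mathrm{ac}}$. **Theorem.** Let $\theta\in K^{\mathrm{ac}}$ be such that $K(\theta)|K$ is a minimal purely wild extension, and suppose that, up to a nonzero constant factor, the minimal polynomial of $\theta$ over $K$ is $\mathfrak A(X)-c$, where $c\in K$ and $$\mathfrak A(X)=\sum_{i=0}^{n}a_iX^{p^i}\in\mathcal O_K[X],\qquad \nu a_0=\nu a_n=0.$$ Let $\mathfrak A\nu\in K\nu[X]$ be the reduction of $\mathfrak A$ and suppose that $K\nu$ is not $\mathfrak A\nu$-closed, i.e. there is $d\in K\nu$ such that $\mathfrak A\nu(X)-d$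 has no root in $K\nu$. Then the maximal purely wild extensions of $K$ are not unique up to isomorphism over $K$: there exist two maximal purely wild extensions $W_1,W_2\subseteq K^{\mathrm{ac}}$ of $K$ which are not isomorphic as field extensions of $K$. -/

import Mathlib

open Polynomial IntermediateField

/-- A field `k` is `f`-closed when `f(k) = k`, i.e. `f(X) - c` has a root in `k` for all `c`. -/
def IsPolyClosed {k : Type*} [Field k] (f : k[X]) : Prop :=
  Function.Surjective fun x : k => f.eval x

/-- The extension of valued fields `(L, vL)` over `(K, vK)` (with residue characteristic `p`) is
purely wild: it is algebraic, the quotient of the value group of `L` by the value group of `K`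
is a `p`-group, and the residue field extension is purely inseparable.

The value group of `K` is formed inside the value group of `L`, through the restriction of `vL`
to `K`, which is equivalent to `vK`. -/
structure IsPurelyWild (p : ℕ) {K L Γ₀ Γ₁ : Type*} [Field K] [Field L] [Algebra K L]
    [LinearOrderedCommGroupWithZero Γ₀] [LinearOrderedCommGroupWithZero Γ₁]
    (vK : Valuation K Γ₀) (vL : Valuation L Γ₁) [vK.HasExtension vL] : Prop where
  isAlgebraic : Algebra.IsAlgebraic K L
  isPGroup_valueGroup : IsPGroup p
    (MonoidWithZeroHom.valueGroup vL.toMonoidWithZeroHom ⧸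
      (MonoidWithZeroHom.valueGroup (vL.comap (algebraMap K L)).toMonoidWithZeroHom).subgroupOf
        (MonoidWithZeroHom.valueGroup vL.toMonoidWithZeroHom))
  isPurelyInseparable_residueField : IsPurelyInseparable
    (IsLocalRing.ResidueField vK.valuationSubring) (IsLocalRing.ResidueField vL.valuationSubring)

section Subextension

variable {K Ω Γ₀ Γ₁ : Type*} [Field K] [Field Ω] [Algebra K Ω]
  [LinearOrderedCommGroupWithZero Γ₀] [LinearOrderedCommGroupWithZero Γ₁]

/-- If `w` on `Ω` extends `v` on `K`, then so does its restriction to an intermediate field. -/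
instance hasExtension_comap_intermediateField (v : Valuation K Γ₀) (w : Valuation Ω Γ₁)
    [v.HasExtension w] (L : IntermediateField K Ω) :
    v.HasExtension (w.comap (algebraMap L Ω)) where
  val_isEquiv_comap := Valuation.HasExtension.val_isEquiv_comap (vR := v) (vA := w)

/-- The intermediate field `L` of `Ω | K`, with the restriction of `w`, is a purely wild
extension of `(K, v)`. -/
def IsPurelyWildSubext (p : ℕ) (v : Valuation K Γ₀) (w : Valuation Ω Γ₁) [v.HasExtension w]
    (L : IntermediateField K Ω) : Prop :=
  IsPurelyWild p v (w.comap (algebraMap L Ω))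

/-- A minimal purely wild extension: a purely wild extension without proper nontrivial
subextensions. -/
def IsMinimalPurelyWildSubext (p : ℕ) (v : Valuation K Γ₀) (w : Valuation Ω Γ₁)
    [v.HasExtension w] (L : IntermediateField K Ω) : Prop :=
  IsPurelyWildSubext p v w L ∧ ∀ E : IntermediateField K Ω, E ≤ L → E = ⊥ ∨ E = L

/-- A maximal purely wild extension of `K` inside `Ω`: a purely wild extension which is not
properly contained in another one. -/
def IsMaximalPurelyWildSubext (p : ℕ) (v : Valuation K Γ₀) (w : Valuation Ω Γ₁)
    [v.HasExtension w] (L : IntermediateField K Ω) : Prop :=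
  Maximal (IsPurelyWildSubext p v w) L

end Subextension

/-- The additive polynomial `∑_{i ≤ n} a_i X^{p^i}`. -/
noncomputable def additivePoly {R : Type*} [CommRing R] (p n : ℕ) (a : ℕ → R) : R[X] :=
  ∑ i ∈ Finset.range (n + 1), C (a i) * X ^ p ^ i

/-!
Write `𝔄` for the additive polynomial. Choose `b` in the valuation ring of `K` such that the
reduction of `𝔄(X) - b` has no root in the residue field, and a root `β ∈ Ω` of `𝔄(X) - b`. The
point is that `K(θ + β)`, generated by a root of `𝔄(X) - (c + b)`, is again purely wild. Let `W₁`
and `W₂` be maximal purely wild extensions containing `K(θ)` and `K(θ + β)`, respectively. If they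
were isomorphic over `K`, then `W₂` would contain a root of `𝔄(X) - c` too, hence by additivity a
root of `𝔄(X) - b`. This root is integral and its conjugates have distinct residues, so in a purely
wild extension it has to lie in `K`, and its residue contradicts the choice of `b`.

Everything is expressed through the action of the group of `K`-automorphisms of `Ω`. Hensel's lemma
enters only in `Valuation.map_algEquiv_of_henselian`: the valuation `w` is invariant under
conjugation. Given this, `L` is purely wild if and only if `w (σ x - x) < w x` for all
automorphisms `σ` and all nonzero `x ∈ L`
(`isPurelyWildSubext_iff_isAsymptoticallyFixed`); in ramification theory this says that the
ramification group already has the same orbits on `L` as the full group.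

That `K(θ + β)` inherits this property from `K(θ)` is `IsAsymptoticallyFixed.adjoin_add`. Every
conjugate of `θ + β` is of the form `τ θ + β`, because the roots of the irreducible polynomial
`𝔄(X) - c` are permuted by translation with roots of `𝔄`. An element of `K(θ + β)` is a
combination of powers of `β` with coefficients in `K(θ)`, and these powers are valuation
independent over `K(θ)` (`IsAsymptoticallyFixed.coeff_le_aeval`); so an asymptotically negligible
change of the coefficients changes the element by an asymptotically negligible amount.
-/

/-! ### Uniqueness of the extension of a henselian valuation -/

section Unique

variable {K Ω Γ₀ Γ₁ : Type*} [Field K] [Field Ω] [Algebra K Ω]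
  [LinearOrderedCommGroupWithZero Γ₀] [LinearOrderedCommGroupWithZero Γ₁]

theorem Polynomial.mem_lifts_valuationSubring_iff (w : Valuation Ω Γ₁) (f : Polynomial Ω) :
    f ∈ lifts (algebraMap w.valuationSubring Ω) ↔ ∀ i, w (f.coeff i) ≤ 1 := by
  rw [lifts_iff_coeff_lifts]
  refine forall_congr' fun i => ⟨?_, fun h => ⟨⟨_, h⟩, rfl⟩⟩
  rintro ⟨x, hx⟩
  rw [← hx]
  exact x.2

theorem Valuation.eval_le_one_of_mem_lifts (w : Valuation Ω Γ₁) {f : Polynomial Ω}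
    (hf : f ∈ lifts (algebraMap w.valuationSubring Ω)) {x : Ω} (hx : w x ≤ 1) :
    w (f.eval x) ≤ 1 := by
  rw [Polynomial.mem_lifts_valuationSubring_iff] at hf
  rw [eval_eq_sum_range]
  refine w.map_sum_le fun i _ => ?_
  rw [map_mul, map_pow]
  exact mul_le_one' (hf i) (pow_le_one' hx i)

theorem Valuation.isUnit_valuationSubring_iff (v : Valuation K Γ₀) (x : v.valuationSubring) :
    IsUnit x ↔ v (x : K) = 1 :=
  Valuation.Integers.isUnit_iff_valuation_eq_one (Valuation.integer.integers v) (x := x)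

theorem Valuation.X_sub_C_mem_lifts (w : Valuation Ω Γ₁) {x : Ω} (hx : w x ≤ 1) :
    X - C x ∈ lifts (algebraMap w.valuationSubring Ω) :=
  (mem_lifts _).2 ⟨X - C ⟨x, hx⟩, by simp⟩

theorem Valuation.prod_X_sub_C_mem_lifts (w : Valuation Ω Γ₁) {s : Multiset Ω}
    (hs : ∀ r ∈ s, w r ≤ 1) :
    (s.map fun r => X - C r).prod ∈ lifts (algebraMap w.valuationSubring Ω) := by
  refine multiset_prod_mem _ fun f hf => ?_
  obtain ⟨r, hr, rfl⟩ := Multiset.mem_map.1 hf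
  exact w.X_sub_C_mem_lifts (hs r hr)

theorem Valuation.multiset_prod_one_sub_eq_one (w : Valuation Ω Γ₁) {s : Multiset Ω}
    (hs : ∀ r ∈ s, w r < 1) : w (s.map fun r => 1 - r).prod = 1 := by
  induction s using Multiset.induction_on with
  | empty => simp
  | cons a s ih =>
    rw [Multiset.map_cons, Multiset.prod_cons, map_mul,
      ih fun r hr => hs r (Multiset.mem_cons_of_mem hr), mul_one]
    exact w.map_one_sub_of_lt (hs a (Multiset.mem_cons_self a s))

theorem exists_algEquiv_of_mem_aroots [Normal K Ω] {x y : Ω} (h : y ∈ (minpoly K x).aroots Ω) :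
    ∃ σ : Ω ≃ₐ[K] Ω, σ x = y :=
  minpoly.exists_algEquiv_of_root' (Normal.isIntegral inferInstance x).isAlgebraic
    (mem_aroots.1 h).2

/-- A form of Hensel's lemma: if exactly one of the conjugates of a separable element, and that
one with multiplicity one, is a principal unit while the others have positive value, then this
conjugate reduces to a simple root of the reduced minimal polynomial, hence lies in `K`. -/
theorem mem_range_algebraMap_of_sub_one_lt [IsAlgClosure K Ω] (v : Valuation K Γ₀)
    (w : Valuation Ω Γ₁) [v.HasExtension w] [HenselianLocalRing v.valuationSubring] {u : Ω}
    (hsep : IsSeparable K u) (hu : w (u - 1) < 1)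
    (hconj : ∀ σ : Ω ≃ₐ[K] Ω, σ u ≠ u → w (σ u) < 1) :
    u ∈ Set.range (algebraMap K Ω) := by
  have : IsAlgClosed Ω := IsAlgClosure.isAlgClosed K
  have hint : IsIntegral K u := (IsAlgClosure.isAlgebraic (R := K)).isIntegral.isIntegral u
  have hu1 : w u = 1 := by simpa using w.map_eq_of_sub_lt (y := u) (x := 1) (by simpa using hu)
  set g := minpoly K u with hg
  have hmon : g.Monic := minpoly.monic hint
  have hprod : g.map (algebraMap K Ω) = ((g.aroots Ω).map fun r => X - C r).prod :=
    (IsAlgClosed.splits _).eq_prod_roots_of_monic (hmon.map _)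
  have hmem : u ∈ g.aroots Ω := mem_aroots.2 ⟨hmon.ne_zero, minpoly.aeval K u⟩
  obtain ⟨s, hs⟩ := Multiset.exists_cons_of_mem hmem
  have hnd : (g.aroots Ω).Nodup := nodup_aroots_iff_of_splits hmon.ne_zero
    (IsAlgClosed.splits _) |>.2 hsep
  have hslt : ∀ r ∈ s, w r < 1 := by
    intro r hr
    obtain ⟨σ, rfl⟩ := exists_algEquiv_of_mem_aroots (K := K) (x := u) (y := r)
      (by rw [← hg, hs]; exact Multiset.mem_cons_of_mem hr)
    refine hconj σ fun h => ?_
    rw [hs, Multiset.nodup_cons] at hnd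
    exact hnd.1 (h ▸ hr)
  rw [hs, Multiset.map_cons, Multiset.prod_cons] at hprod
  set q := (s.map fun r => X - C r).prod with hq
  have hqint : q ∈ lifts (algebraMap w.valuationSubring Ω) :=
    w.prod_X_sub_C_mem_lifts fun r hr => (hslt r hr).le
  have hgint : ∀ i, w ((g.map (algebraMap K Ω)).coeff i) ≤ 1 := by
    rw [← Polynomial.mem_lifts_valuationSubring_iff, hprod]
    exact mul_mem (w.X_sub_C_mem_lifts hu1.le) hqint
  have hq1 : w (q.eval 1) = 1 := by
    rw [hq, eval_multiset_prod, Multiset.map_map]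
    simpa using w.multiset_prod_one_sub_eq_one hslt
  have hq1' : w (q.derivative.eval 1) ≤ 1 := by
    refine w.eval_le_one_of_mem_lifts ?_ (by simp)
    obtain ⟨q₀, hq₀⟩ := (mem_lifts _).1 hqint
    exact (mem_lifts _).2 ⟨derivative q₀, by rw [← derivative_map, hq₀]⟩
  have hu' : w (1 - u) < 1 := by rwa [w.map_sub_swap]
  obtain ⟨g₀, hg₀, -, hg₀m⟩ := lifts_and_natDegree_eq_and_monic
    (f := algebraMap v.valuationSubring K) (p := g)
    ((Polynomial.mem_lifts_valuationSubring_iff v g).2 fun i => by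
      have := hgint i
      rwa [coeff_map, Valuation.HasExtension.val_map_le_one_iff v w] at this) hmon
  have hev (h : v.valuationSubring[X]) :
      algebraMap K Ω (algebraMap v.valuationSubring K (h.eval 1)) =
        ((h.map (algebraMap v.valuationSubring K)).map (algebraMap K Ω)).eval 1 := by
    rw [Polynomial.map_map, eval_map, ← RingHom.comp_apply,
      ← map_one ((algebraMap K Ω).comp (algebraMap v.valuationSubring K)), eval₂_at_apply]
  obtain ⟨a, ha, -⟩ := HenselianLocalRing.is_henselian g₀ hg₀m 1 (by
      rw [IsLocalRing.mem_maximalIdeal, mem_nonunits_iff,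
        Valuation.isUnit_valuationSubring_iff]
      refine ne_of_lt ?_
      rw [← Valuation.HasExtension.val_map_lt_one_iff v w]
      refine lt_of_eq_of_lt (congrArg w (hev g₀)) ?_
      rw [hg₀, hprod, eval_mul, map_mul, hq1, mul_one]
      simpa using hu') (by
      rw [Valuation.isUnit_valuationSubring_iff,
        ← Valuation.HasExtension.val_map_eq_one_iff v w]
      refine (congrArg w (hev _)).trans ?_
      rw [← derivative_map, ← derivative_map, hg₀, hprod, derivative_mul, eval_add, eval_mul,
        eval_mul, add_comm]
      refine (w.map_eq_of_sub_lt (x := q.eval 1) ?_).trans hq1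
      simp only [derivative_sub, derivative_X, derivative_C, sub_zero, eval_one, one_mul,
        eval_sub, eval_X, eval_C]
      rw [add_sub_cancel_right, map_mul, hq1]
      exact mul_lt_one_of_lt_of_le hu' hq1')
  have hroot : aeval (algebraMap K Ω (a : K)) g = 0 := by
    rw [aeval_algebraMap_apply, ← hg₀, aeval_def, Algebra.algebraMap_self, eval₂_id, 
      show (a : K) = algebraMap v.valuationSubring K a from rfl, eval_map, eval₂_at_apply, ha]
    simp
  obtain ⟨σ, hσ⟩ := minpoly.exists_algEquiv_of_root' hint.isAlgebraic hroot
  exact ⟨a, by rw [← σ.injective.eq_iff, hσ, σ.commutes]⟩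

/-- If a separable element strictly dominates all its other conjugates, then it lies in `K`:
it is asymptotically equal to its trace, and dividing by the trace gives a principal unit all of
whose other conjugates have positive value. -/
theorem mem_range_algebraMap_of_conj_lt [IsAlgClosure K Ω] (v : Valuation K Γ₀)
    (w : Valuation Ω Γ₁) [v.HasExtension w] [HenselianLocalRing v.valuationSubring] {t : Ω}
    (hsep : IsSeparable K t) (hconj : ∀ σ : Ω ≃ₐ[K] Ω, σ t ≠ t → w (σ t) < w t) :
    t ∈ Set.range (algebraMap K Ω) := by
  have : IsAlgClosed Ω := IsAlgClosure.isAlgClosed K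
  rcases eq_or_ne t 0 with rfl | ht
  · exact ⟨0, map_zero _⟩
  have hint : IsIntegral K t := (IsAlgClosure.isAlgebraic (R := K)).isIntegral.isIntegral t
  set g := minpoly K t with hg
  have hmon : g.Monic := minpoly.monic hint
  have hmem : t ∈ g.aroots Ω := mem_aroots.2 ⟨hmon.ne_zero, minpoly.aeval K t⟩
  obtain ⟨s, hs⟩ := Multiset.exists_cons_of_mem hmem
  have hnd : (g.aroots Ω).Nodup := nodup_aroots_iff_of_splits hmon.ne_zero
    (IsAlgClosed.splits _) |>.2 hsep
  have hslt : ∀ r ∈ s, w r < w t := by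
    intro r hr
    obtain ⟨σ, rfl⟩ := exists_algEquiv_of_mem_aroots (K := K) (x := t) (y := r)
      (by rw [← hg, hs]; exact Multiset.mem_cons_of_mem hr)
    refine hconj σ fun h => ?_
    rw [hs, Multiset.nodup_cons] at hnd
    exact hnd.1 (h ▸ hr)
  have hsum : (g.map (algebraMap K Ω)).nextCoeff = -(g.aroots Ω).sum :=
    (IsAlgClosed.splits _).nextCoeff_eq_neg_sum_roots_of_monic (hmon.map _)
  rw [nextCoeff_map (algebraMap K Ω).injective, hs, Multiset.sum_cons] at hsum
  set c := -g.nextCoeff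
  have hc : algebraMap K Ω c = t + s.sum := by rw [map_neg, hsum, neg_neg]
  have hlt : w s.sum < w t := by
    clear hs hsum hc
    induction s using Multiset.induction_on with
    | empty => simpa [zero_lt_iff] using ht
    | cons a s ih =>
      rw [Multiset.sum_cons]
      exact w.map_add_lt (hslt a (Multiset.mem_cons_self a s))
        (ih fun r hr => hslt r (Multiset.mem_cons_of_mem hr))
  have hwc : w (algebraMap K Ω c) = w t := by rw [hc, w.map_add_eq_of_lt_left hlt]
  have hwt : 0 < w t := by simpa [zero_lt_iff] using ht
  have hc0 : algebraMap K Ω c ≠ 0 := by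
    rw [← w.ne_zero_iff, hwc]
    exact hwt.ne'
  obtain ⟨y, hy⟩ := mem_range_algebraMap_of_sub_one_lt v w (u := t / algebraMap K Ω c)
    (by
      rw [← mem_separableClosure_iff] at hsep ⊢
      exact div_mem hsep (IntermediateField.algebraMap_mem _ c))
    (by
      rw [div_sub_one hc0, map_div₀, hwc, div_lt_one₀ hwt, hc, w.map_sub_swap]
      simpa using hlt)
    (fun σ hσ => by
      rw [map_div₀, σ.commutes, map_div₀, hwc, div_lt_one₀ hwt]
      exact hconj σ fun h => hσ (by rw [map_div₀, σ.commutes, h]))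
  exact ⟨y * c, by rw [map_mul, hy, div_mul_cancel₀ _ hc0]⟩

/-- Conjugate separable elements have the same value: the product `y` of the conjugates of maximal
value strictly dominates its other conjugates, hence lies in `K`. As `y` is then fixed under
conjugation, every conjugate of `x` has maximal value. -/
theorem Valuation.map_algEquiv_of_isSeparable [IsAlgClosure K Ω] (v : Valuation K Γ₀)
    (w : Valuation Ω Γ₁) [v.HasExtension w] [HenselianLocalRing v.valuationSubring] {x : Ω}
    (hsep : IsSeparable K x) (σ : Ω ≃ₐ[K] Ω) : w (σ x) = w x := by
  classical
  rcases eq_or_ne x 0 with rfl | hx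
  · simp
  have hint : IsIntegral K x := (IsAlgClosure.isAlgebraic (R := K)).isIntegral.isIntegral x
  have hne := minpoly.ne_zero hint
  set R := ((minpoly K x).aroots Ω).toFinset with hR
  have hxR : x ∈ R := Multiset.mem_toFinset.2 (mem_aroots.2 ⟨hne, minpoly.aeval K x⟩)
  have hRσ : ∀ (τ : Ω ≃ₐ[K] Ω), ∀ r ∈ R, τ r ∈ R := by
    intro τ r hr
    rw [hR, Multiset.mem_toFinset, mem_aroots] at hr ⊢
    exact ⟨hne, by rw [← AlgEquiv.coe_toAlgHom, aeval_algHom_apply, hr.2, map_zero]⟩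
  obtain ⟨m, hmR, hm⟩ := R.exists_max_image w ⟨x, hxR⟩
  have hRconj : ∀ r ∈ R, ∃ τ : Ω ≃ₐ[K] Ω, τ x = r := fun r hr =>
    exists_algEquiv_of_mem_aroots (Multiset.mem_toFinset.1 hr)
  have hR0 : ∀ r ∈ R, r ≠ 0 := by
    intro r hr
    obtain ⟨τ, rfl⟩ := hRconj r hr
    simpa using hx
  set T := R.filter fun r => w r = w m with hT
  have hTm : ∀ r ∈ T, r ∈ R ∧ w r = w m := fun r hr => Finset.mem_filter.1 hr
  set y := ∏ r ∈ T, r with hy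
  -- A conjugate of `y` has at most the value of `y`, with equality only if `T` is preserved.
  have key : ∀ τ : Ω ≃ₐ[K] Ω, (∀ r ∈ T, τ r ∈ T) ∨ w (τ y) < w y := by
    intro τ
    by_contra! h
    obtain ⟨⟨r, hr, hrT⟩, h⟩ := h
    refine h.not_gt ?_
    rw [hy, map_prod, map_prod, map_prod]
    refine Finset.prod_lt_prod (fun i hi => ?_) (fun i hi => ?_) ⟨r, hr, ?_⟩
    · simpa [zero_lt_iff] using hR0 i (hTm i hi).1
    · rw [(hTm i hi).2]
      exact hm _ (hRσ τ i (hTm i hi).1)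
    · rw [(hTm r hr).2]
      refine lt_of_le_of_ne (hm _ (hRσ τ r (hTm r hr).1)) fun h => hrT ?_
      exact Finset.mem_filter.2 ⟨hRσ τ r (hTm r hr).1, h⟩
  have hyK : y ∈ Set.range (algebraMap K Ω) := by
    refine mem_range_algebraMap_of_conj_lt v w ?_ fun τ hτ => (key τ).resolve_left fun h => hτ ?_
    · rw [← mem_separableClosure_iff]
      refine prod_mem fun r hr => ?_
      obtain ⟨τ, rfl⟩ := hRconj r (hTm r hr).1
      rw [mem_separableClosure_iff, IsSeparable, minpoly.algEquiv_eq]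
      exact hsep
    · rw [hy, map_prod, ← Finset.prod_image (f := fun r => r) τ.injective.injOn,
        Finset.eq_of_subset_of_card_le (Finset.image_subset_iff.2 h)
          (Finset.card_image_of_injective T τ.injective).ge]
  have hTσ : ∀ (τ : Ω ≃ₐ[K] Ω), ∀ r ∈ T, τ r ∈ T := by
    intro τ
    refine (key τ).resolve_right fun h => ?_
    obtain ⟨z, hz⟩ := hyK
    rw [← hz, τ.commutes] at h
    exact h.false
  have hconst : ∀ r ∈ R, w r = w m := by
    intro r hr
    obtain ⟨τ, rfl⟩ := hRconj r hr
    obtain ⟨ρ, hρ⟩ := hRconj m hmR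
    refine (hTm _ ?_).2
    rw [show τ x = (ρ.symm.trans τ) m by simp [← hρ]]
    exact hTσ _ m (Finset.mem_filter.2 ⟨hmR, rfl⟩)
  rw [hconst x hxR, hconst _ (hRσ σ x hxR)]

/-- The extension of a henselian valuation to the algebraic closure is unique, hence invariant
under conjugation. -/
theorem Valuation.map_algEquiv_of_henselian [IsAlgClosure K Ω] (v : Valuation K Γ₀)
    (w : Valuation Ω Γ₁) [v.HasExtension w] [HenselianLocalRing v.valuationSubring]
    (σ : Ω ≃ₐ[K] Ω) (x : Ω) : w (σ x) = w x := by
  have : Algebra.IsAlgebraic K Ω := IsAlgClosure.isAlgebraic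
  obtain ⟨k, y, hy⟩ := IsPurelyInseparable.pow_mem (separableClosure K Ω) (ringExpChar K) x
  have h := v.map_algEquiv_of_isSeparable w (x := x ^ ringExpChar K ^ k)
    (by rw [← hy]; exact mem_separableClosure_iff.1 y.2) σ
  rw [map_pow, map_pow, map_pow] at h
  exact (pow_left_inj₀ zero_le zero_le (pow_pos (expChar_pos K _) k).ne').1 h

end Unique

/-! ### Purely wild extensions and conjugation -/

section Asymptotic

variable {K Ω Γ₀ Γ₁ : Type*} [Field K] [Field Ω] [Algebra K Ω]
  [LinearOrderedCommGroupWithZero Γ₀] [LinearOrderedCommGroupWithZero Γ₁]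

/-- The conditions on the value group and on the residue field combine into one condition on
elements: every `x ≠ 0` of `L` has a power `x ^ p ^ k` asymptotically equal to an element of `K`. -/
theorem isPurelyWildSubext_iff_exists_pow [Algebra.IsAlgebraic K Ω] (p : ℕ) [Fact p.Prime]
    [CharP K p] (v : Valuation K Γ₀) (w : Valuation Ω Γ₁) [v.HasExtension w]
    (L : IntermediateField K Ω) :
    IsPurelyWildSubext p v w L ↔ ∀ x ∈ L, x ≠ 0 →
      ∃ (k : ℕ) (y : K), w (algebraMap K Ω y - x ^ p ^ k) < w (x ^ p ^ k) := by
  have hp : p.Prime := Fact.out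
  have : CharP v.valuationSubring p :=
    (algebraMap v.valuationSubring K).charP Subtype.coe_injective p
  have : CharP (IsLocalRing.ResidueField v.valuationSubring) p := by
    refine (CharP.charP_iff_prime_eq_zero hp).2 ?_
    rw [← map_natCast (IsLocalRing.residue v.valuationSubring), CharP.cast_eq_zero, map_zero]
  set wL : Valuation L Γ₁ := w.comap (algebraMap L Ω) with hwL
  have hext : v.HasExtension wL := inferInstance
  constructor
  · rintro ⟨-, hgroup, hres⟩ x hx hx0
    have hwx : w x ≠ 0 := by simpa using hx0
    obtain ⟨k, hk⟩ := hgroup (QuotientGroup.mk ⟨Units.mk0 (w x) hwx,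
      MonoidWithZeroHom.mem_valueGroup _ ⟨⟨x, hx⟩, rfl⟩⟩)
    rw [← QuotientGroup.mk_pow, QuotientGroup.eq_one_iff, Subgroup.mem_subgroupOf,
      MonoidWithZeroHom.mem_valueGroup_iff_of_comm] at hk
    obtain ⟨a, ha, b, hb⟩ := hk
    have ha' : w (algebraMap K Ω a) ≠ 0 := ha
    have hb' : w (algebraMap K Ω a) * w x ^ p ^ k = w (algebraMap K Ω b) := hb
    obtain ⟨c, hy⟩ : ∃ c, w (algebraMap K Ω c) = w x ^ p ^ k :=
      ⟨b / a, by rw [map_div₀, map_div₀, ← hb', mul_div_cancel_left₀ _ ha']⟩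
    have hc0 : algebraMap K Ω c ≠ 0 := by
      rw [← w.ne_zero_iff, hy]
      exact pow_ne_zero _ hwx
    have hu : w (x ^ p ^ k / algebraMap K Ω c) = 1 := by
      rw [map_div₀, hy, map_pow, div_self (pow_ne_zero _ hwx)]
    have huL : x ^ p ^ k / algebraMap K Ω c ∈ L := div_mem (pow_mem hx _) (L.algebraMap_mem c)
    obtain ⟨j, z, hz⟩ := (isPurelyInseparable_iff_pow_mem
      (IsLocalRing.ResidueField v.valuationSubring) p).1 hres
      (IsLocalRing.residue wL.valuationSubring ⟨⟨_, huL⟩, hu.le⟩)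
    obtain ⟨z, rfl⟩ := IsLocalRing.residue_surjective z
    rw [Valuation.HasExtension.algebraMap_residue_eq_residue_algebraMap, ← map_pow,
      ← sub_eq_zero, ← map_sub, IsLocalRing.residue_eq_zero_iff, IsLocalRing.mem_maximalIdeal,
      mem_nonunits_iff, Valuation.isUnit_valuationSubring_iff] at hz
    have hz' : w (algebraMap K Ω z - (x ^ p ^ k / algebraMap K Ω c) ^ p ^ j) < 1 :=
      lt_of_le_of_ne ((w.map_sub _ _).trans (max_le
        ((Valuation.HasExtension.val_map_le_one_iff v w _).2 z.2)
        (by rw [map_pow, hu, one_pow]))) hz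
    refine ⟨k + j, c ^ p ^ j * z, ?_⟩
    have hcj : algebraMap K Ω c ^ p ^ j ≠ 0 := pow_ne_zero _ hc0
    have e : algebraMap K Ω (c ^ p ^ j * z) - x ^ p ^ (k + j) = algebraMap K Ω c ^ p ^ j *
        (algebraMap K Ω z - (x ^ p ^ k / algebraMap K Ω c) ^ p ^ j) := by
      rw [mul_sub, div_pow, mul_div_cancel₀ _ hcj, map_mul, map_pow, ← pow_mul, pow_add]
    have hw : w (x ^ p ^ (k + j)) = w (algebraMap K Ω c ^ p ^ j) := by
      rw [map_pow w (algebraMap K Ω c), hy, map_pow, ← pow_mul, pow_add]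
    rw [e, map_mul, hw]
    exact mul_lt_of_lt_one_right (by simpa [zero_lt_iff] using hcj) hz'
  · intro h
    refine ⟨inferInstance, ?_, ?_⟩
    · intro g
      obtain ⟨⟨γ, hγ⟩, rfl⟩ := QuotientGroup.mk_surjective g
      obtain ⟨a, ha, b, hb⟩ := (MonoidWithZeroHom.mem_valueGroup_iff_of_comm _).1 hγ
      have ha' : wL a ≠ 0 := ha
      have hb' : wL a * γ = wL b := hb
      have hx : w ((b / a : L) : Ω) = γ := by
        change wL (b / a) = γ
        rw [map_div₀, ← hb', mul_div_cancel_left₀ _ ha']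
      obtain ⟨k, y, hy⟩ := h _ (b / a : L).2 (by
        rw [← w.ne_zero_iff, hx]
        exact γ.ne_zero)
      refine ⟨k, ?_⟩
      rw [← QuotientGroup.mk_pow, QuotientGroup.eq_one_iff, Subgroup.mem_subgroupOf]
      refine MonoidWithZeroHom.mem_valueGroup _ ⟨y, ?_⟩
      change w (algebraMap K Ω y) = (γ : Γ₁) ^ p ^ k
      rw [w.map_eq_of_sub_lt hy, map_pow, hx]
    · refine (isPurelyInseparable_iff_pow_mem
        (IsLocalRing.ResidueField v.valuationSubring) p).2 fun r => ?_
      obtain ⟨⟨⟨x, hxL⟩, hx⟩, rfl⟩ := IsLocalRing.residue_surjective r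
      have hx' : w x ≤ 1 := hx
      rcases hx'.lt_or_eq with hlt | h1
      · refine ⟨0, 0, ?_⟩
        rw [map_zero, pow_zero, pow_one, eq_comm, IsLocalRing.residue_eq_zero_iff,
          IsLocalRing.mem_maximalIdeal, mem_nonunits_iff, Valuation.isUnit_valuationSubring_iff]
        exact hlt.ne
      · obtain ⟨k, y, hy⟩ := h x hxL (by rw [← w.ne_zero_iff, h1]; exact one_ne_zero)
        have hwy : v y ≤ 1 := by
          rw [← Valuation.HasExtension.val_map_le_one_iff v w, w.map_eq_of_sub_lt hy, map_pow, h1,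
            one_pow]
        refine ⟨k, IsLocalRing.residue v.valuationSubring ⟨y, hwy⟩, ?_⟩
        rw [Valuation.HasExtension.algebraMap_residue_eq_residue_algebraMap, ← map_pow,
          ← sub_eq_zero, ← map_sub, IsLocalRing.residue_eq_zero_iff, IsLocalRing.mem_maximalIdeal,
          mem_nonunits_iff, Valuation.isUnit_valuationSubring_iff]
        rw [map_pow, h1, one_pow] at hy
        exact hy.ne

/-- The subextension `L` of `Ω | K` is asymptotically fixed when every `K`-automorphism `σ` of `Ω`
fixes the nonzero elements of `L` up to a factor in `1 + 𝔪`, where `𝔪` is the maximal ideal of the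
valuation ring of `w`. -/
def IsAsymptoticallyFixed (w : Valuation Ω Γ₁) (L : IntermediateField K Ω) : Prop :=
  ∀ σ : Ω ≃ₐ[K] Ω, ∀ x ∈ L, x ≠ 0 → w (σ x - x) < w x

/-- If the elements of `s` are asymptotically equal to `x`, then the elementary symmetric functions
of `s` agree with those of `s.card` copies of `x` up to terms of smaller value. -/
theorem Valuation.esymm_sub_choose_mul_pow_lt (w : Valuation Ω Γ₁) {x : Ω} (hx : x ≠ 0)
    (s : Multiset Ω) (hs : ∀ r ∈ s, w (r - x) < w x) (j : ℕ) :
    w (s.esymm j - (s.card.choose j : Ω) * x ^ j) < w x ^ j := by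
  have hwx : 0 < w x := by simpa [zero_lt_iff] using hx
  induction s using Multiset.induction_on generalizing j with
  | empty =>
    cases j with
    | zero => simp [Multiset.esymm]
    | succ j => simpa [Multiset.esymm, Multiset.powersetCard_zero_right] using pow_pos hwx (j + 1)
  | cons a s ih =>
    cases j with
    | zero => simp [Multiset.esymm]
    | succ j =>
      have ih' := ih fun r hr => hs r (Multiset.mem_cons_of_mem hr)
      have ha := hs a (Multiset.mem_cons_self a s)
      have e : (a ::ₘ s).esymm (j + 1) - ((a ::ₘ s).card.choose (j + 1) : Ω) * x ^ (j + 1) =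
          (s.esymm (j + 1) - (s.card.choose (j + 1) : Ω) * x ^ (j + 1)) +
            a * (s.esymm j - (s.card.choose j : Ω) * x ^ j) +
            (a - x) * ((s.card.choose j : Ω) * x ^ j) := by
        have : (a ::ₘ s).esymm (j + 1) = s.esymm (j + 1) + a * s.esymm j := by
          simp [Multiset.esymm, Multiset.powersetCard_cons, Multiset.sum_map_mul_left]
        rw [this, Multiset.card_cons, Nat.choose_succ_succ]
        push_cast
        ring
      rw [e]
      refine w.map_add_lt (w.map_add_lt (ih' _) ?_) ?_
      · rw [map_mul, w.map_eq_of_sub_lt ha, pow_succ']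
        exact mul_lt_mul_of_pos_left (ih' j) hwx
      · rw [map_mul, map_mul, map_pow, pow_succ']
        refine (mul_le_mul_right (mul_le_of_le_one_left' ?_) _).trans_lt
          (mul_lt_mul_of_pos_right ha (pow_pos hwx j))
        exact natCast_mem w.valuationSubring (s.card.choose j)

theorem Valuation.map_natCast_eq_one_of_not_dvd {p : ℕ} [Fact p.Prime] [CharP Ω p]
    (w : Valuation Ω Γ₁) {m : ℕ} (hm : ¬ p ∣ m) : w (m : Ω) = 1 := by
  have hp : p.Prime := Fact.out
  have h := Nat.ModEq.pow_totient (hp.coprime_iff_not_dvd.2 hm).symm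
  rw [← CharP.natCast_eq_natCast Ω, Nat.cast_pow, Nat.cast_one] at h
  have h' := congrArg w h
  rw [map_pow, map_one] at h'
  exact (pow_eq_one_iff_of_nonneg zero_le (Nat.totient_pos.2 hp.pos).ne').1 h'

/-- In characteristic `p`, an element `x` which is asymptotically fixed by conjugation has some
power `x ^ p ^ k` asymptotically equal to an element of `K`. The latter is obtained, up to an
integer prime to `p`, as the elementary symmetric function of degree `p ^ k` in the conjugates of
`x`, where `p ^ k` is the largest power of `p` dividing the degree of `x`. -/
theorem exists_pow_of_forall_conj_sub_lt [Normal K Ω] [IsAlgClosed Ω] (p : ℕ) [Fact p.Prime]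
    [CharP K p] (w : Valuation Ω Γ₁) {x : Ω} (hx : x ≠ 0)
    (h : ∀ σ : Ω ≃ₐ[K] Ω, w (σ x - x) < w x) :
    ∃ (k : ℕ) (y : K), w (algebraMap K Ω y - x ^ p ^ k) < w (x ^ p ^ k) := by
  have hp : p.Prime := Fact.out
  have : CharP Ω p := charP_of_injective_algebraMap (algebraMap K Ω).injective p
  have hint : IsIntegral K x := Normal.isIntegral inferInstance x
  set f := minpoly K x with hf
  have hmon : f.Monic := minpoly.monic hint
  obtain ⟨k, m, hm, hd⟩ := Nat.exists_eq_pow_mul_and_not_dvd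
    (minpoly.natDegree_pos hint).ne' p hp.ne_one
  have hle : p ^ k ≤ f.natDegree := Nat.le_of_dvd (minpoly.natDegree_pos hint) ⟨m, hd⟩
  have hcard : (f.aroots Ω).card = f.natDegree := by
    rw [← natDegree_map (algebraMap K Ω)]
    exact (IsAlgClosed.splits _).natDegree_eq_card_roots.symm
  have hcoeff := coeff_eq_esymm_roots_of_card (p := f.map (algebraMap K Ω))
    (hcard.trans (natDegree_map _).symm) (k := f.natDegree - p ^ k) (by simp)
  rw [(hmon.map _).leadingCoeff, one_mul, natDegree_map, coeff_map, Nat.sub_sub_self hle] at hcoeff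
  have hlt := w.esymm_sub_choose_mul_pow_lt hx (f.aroots Ω) (fun r hr => by
    obtain ⟨σ, rfl⟩ := exists_algEquiv_of_mem_aroots hr
    exact h σ) (p ^ k)
  rw [hcard] at hlt
  -- By Lucas, `(p ^ k * m).choose (p ^ k)` is congruent to `m` modulo `p`.
  set N := f.natDegree.choose (p ^ k) with hN
  have hNp : ¬ p ∣ N := by
    have := Choose.choose_pow_mul_pow_mul_modEq_choose_nat (p := p) (k := k) (a := m) (b := 1)
    rw [mul_one, ← hd, Nat.choose_one_right] at this
    rwa [(this.dvd_iff dvd_rfl)]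
  have hwN : w (N : Ω) = 1 := w.map_natCast_eq_one_of_not_dvd hNp
  have hN0 : (N : Ω) ≠ 0 := by rw [← w.ne_zero_iff, hwN]; exact one_ne_zero
  refine ⟨k, (-1) ^ p ^ k * f.coeff (f.natDegree - p ^ k) / N, ?_⟩
  have e : algebraMap K Ω ((-1) ^ p ^ k * f.coeff (f.natDegree - p ^ k) / N) - x ^ p ^ k =
      ((f.aroots Ω).esymm (p ^ k) - N * x ^ p ^ k) / N := by
    rw [map_div₀, map_mul, hcoeff, map_pow, map_neg, map_one, map_natCast, ← mul_assoc,
      ← mul_pow, neg_one_mul, neg_neg, one_pow, one_mul, sub_div, mul_div_cancel_left₀ _ hN0]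
  rw [e, map_div₀, hwN, div_one, map_pow]
  exact hlt

/-- Purely wild extensions are exactly the asymptotically fixed ones. One direction needs the
invariance of `w` under conjugation, and that `p`-th powers are injective on residues; the other
one is `exists_pow_of_forall_conj_sub_lt`. -/
theorem isPurelyWildSubext_iff_isAsymptoticallyFixed [IsAlgClosure K Ω] (p : ℕ) [Fact p.Prime]
    [CharP K p] (v : Valuation K Γ₀) (w : Valuation Ω Γ₁) [v.HasExtension w]
    [HenselianLocalRing v.valuationSubring] (L : IntermediateField K Ω) :
    IsPurelyWildSubext p v w L ↔ IsAsymptoticallyFixed w L := by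
  have : IsAlgClosed Ω := IsAlgClosure.isAlgClosed K
  have : Algebra.IsAlgebraic K Ω := IsAlgClosure.isAlgebraic
  have : CharP Ω p := charP_of_injective_algebraMap (algebraMap K Ω).injective p
  rw [isPurelyWildSubext_iff_exists_pow p v w L]
  refine ⟨fun h σ x hxL hx => ?_, fun h x hxL hx =>
    exists_pow_of_forall_conj_sub_lt p w hx fun σ => h σ x hxL hx⟩
  obtain ⟨k, y, hy⟩ := h x hxL hx
  have hy' : w (algebraMap K Ω y - σ x ^ p ^ k) < w (x ^ p ^ k) := by
    rwa [← σ.commutes, ← map_pow, ← map_sub, v.map_algEquiv_of_henselian w]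
  have := w.map_sub_lt hy hy'
  rw [sub_sub_sub_cancel_left, ← sub_pow_char_pow, map_pow, map_pow] at this
  exact lt_of_pow_lt_pow_left₀ _ zero_le this

theorem exists_isMaximalPurelyWildSubext_ge [Algebra.IsAlgebraic K Ω] (p : ℕ) [Fact p.Prime]
    [CharP K p] (v : Valuation K Γ₀) (w : Valuation Ω Γ₁) [v.HasExtension w]
    {L : IntermediateField K Ω} (hL : IsPurelyWildSubext p v w L) :
    ∃ W, L ≤ W ∧ IsMaximalPurelyWildSubext p v w W := by
  refine zorn_le_nonempty₀ {E | IsPurelyWildSubext p v w E} (fun c hc hchain E hE => ?_) L hL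
  refine ⟨sSup c, ?_, fun F hF => le_sSup hF⟩
  rw [Set.mem_ofPred_eq, isPurelyWildSubext_iff_exists_pow]
  intro x hx
  have : Nonempty c := ⟨⟨E, hE⟩⟩
  rw [sSup_eq_iSup', ← SetLike.mem_coe,
    IntermediateField.coe_iSup_of_directed hchain.directedOn.directed_val, Set.mem_iUnion] at hx
  obtain ⟨⟨F, hF⟩, hxF⟩ := hx
  exact (isPurelyWildSubext_iff_exists_pow p v w F).1 (hc hF) x hxF

end Asymptotic

/-! ### Unramified perturbation of a generator -/

section Perturbation

variable {K Ω Γ₀ Γ₁ : Type*} [Field K] [Field Ω] [Algebra K Ω]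
  [LinearOrderedCommGroupWithZero Γ₀] [LinearOrderedCommGroupWithZero Γ₁]

/-- Lagrange interpolation at integral nodes with distinct residues has integral coefficients. -/
theorem Valuation.coeff_lt_of_forall_eval_lt (w : Valuation Ω Γ₁) {f : Polynomial Ω} {s : Finset Ω}
    (hint : ∀ r ∈ s, w r ≤ 1) (hdist : ∀ r ∈ s, ∀ t ∈ s, r ≠ t → w (r - t) = 1)
    (hdeg : f.degree < s.card) {μ : Γ₁} (hμ : 0 < μ) (hf : ∀ r ∈ s, w (f.eval r) < μ) (i : ℕ) :
    w (f.coeff i) < μ := by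
  classical
  rw [Lagrange.eq_interpolate (v := id) (s := s) Function.injective_id.injOn hdeg,
    Lagrange.interpolate_apply, finsetSum_coeff]
  refine w.map_sum_lt hμ.ne' fun r hr => ?_
  rw [coeff_C_mul, map_mul]
  refine mul_lt_of_lt_of_le_one (hf r hr)
    ((Polynomial.mem_lifts_valuationSubring_iff w _).1 (prod_mem fun t ht => ?_) i)
  obtain ⟨htr, hts⟩ := Finset.mem_erase.1 ht
  have hw : w (r - t)⁻¹ ≤ 1 := by rw [map_inv₀, hdist r hr t hts htr.symm, inv_one]
  exact mul_mem (C'_mem_lifts ⟨⟨_, hw⟩, rfl⟩) (w.X_sub_C_mem_lifts (hint t hts))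

/-- If the conjugates of the integral element `β` have pairwise distinct residues, then the powers
`1, β, …, β ^ (d - 1)`, with `d` the degree of `β` over `K`, are valuation independent over every
asymptotically fixed extension `L`. Indeed, replacing `β` by a conjugate changes the value of a
polynomial over `L` only by lower order terms, so a polynomial of degree `< d` which is too small
at `β` is too small at `d` points with distinct residues. -/
theorem IsAsymptoticallyFixed.coeff_le_aeval [IsAlgClosure K Ω] (v : Valuation K Γ₀)
    {w : Valuation Ω Γ₁} [v.HasExtension w] [HenselianLocalRing v.valuationSubring]
    {L : IntermediateField K Ω} (hL : IsAsymptoticallyFixed w L) {β : Ω} (hβ : w β ≤ 1)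
    (hsep : IsSeparable K β) (hres : ∀ σ : Ω ≃ₐ[K] Ω, w (σ β - β) < 1 → σ β = β)
    {P : Polynomial L} (hP : P.degree < (minpoly K β).degree) (i : ℕ) :
    w (P.coeff i) ≤ w (aeval β P) := by
  classical
  have : IsAlgClosed Ω := IsAlgClosure.isAlgClosed K
  have hUw := v.map_algEquiv_of_henselian (K := K) w
  have hint : IsIntegral K β := (IsAlgClosure.isAlgebraic (R := K)).isIntegral.isIntegral β
  by_contra! hlt
  have hi : P.coeff i ≠ 0 := by
    intro h
    simp [h] at hlt
  obtain ⟨j, hj, hmax⟩ := P.support.exists_max_image (fun k => w (P.coeff k : Ω))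
    ⟨i, mem_support_iff.2 hi⟩
  have hj0 : 0 < w (P.coeff j : Ω) := by
    simpa [zero_lt_iff] using mem_support_iff.1 hj
  have hmax' : ∀ k, w (P.coeff k : Ω) ≤ w (P.coeff j : Ω) := by
    intro k
    by_cases hk : P.coeff k = 0
    · simp [hk]
    · exact hmax k (mem_support_iff.2 hk)
  have hnd : ((minpoly K β).aroots Ω).Nodup := nodup_aroots_iff_of_splits (minpoly.ne_zero hint)
    (IsAlgClosed.splits _) |>.2 hsep
  set R := ((minpoly K β).aroots Ω).toFinset with hR
  have hcard : R.card = (minpoly K β).natDegree := by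
    rw [hR, Multiset.toFinset_card_of_nodup hnd, ← natDegree_map (algebraMap K Ω)]
    exact (IsAlgClosed.splits _).natDegree_eq_card_roots.symm
  have hRconj : ∀ r ∈ R, ∃ σ : Ω ≃ₐ[K] Ω, σ β = r := fun r hr =>
    exists_algEquiv_of_mem_aroots (Multiset.mem_toFinset.1 hr)
  refine (w.coeff_lt_of_forall_eval_lt (f := P.map (algebraMap L Ω)) (s := R) (fun r hr => ?_)
    (fun r hr t ht hrt => ?_) ?_ hj0 (fun r hr => ?_) j).ne (by rw [coeff_map]; rfl)
  · obtain ⟨σ, rfl⟩ := hRconj r hr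
    rwa [hUw]
  · obtain ⟨σ, rfl⟩ := hRconj r hr
    obtain ⟨τ, rfl⟩ := hRconj t ht
    refine le_antisymm ((w.map_sub _ _).trans (by rwa [hUw, hUw, max_self])) ?_
    by_contra! h
    refine hrt ?_
    have h' : τ ((σ.trans τ.symm) β - β) = σ β - τ β := by simp
    rw [← h', hUw] at h
    simpa using congrArg τ (hres _ h)
  · rw [degree_map, hcard]
    exact hP.trans_le degree_le_natDegree
  · obtain ⟨σ, rfl⟩ := hRconj r hr
    have e : (P.map (algebraMap L Ω)).eval (σ β) = σ (aeval β P) -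
        ∑ k ∈ Finset.range (P.natDegree + 1),
          (σ (P.coeff k) - P.coeff k) * σ β ^ k := by
      rw [eval_map, eval₂_eq_sum_range, aeval_eq_sum_range, map_sum, ← Finset.sum_sub_distrib]
      refine Finset.sum_congr rfl fun k _ => ?_
      rw [Algebra.smul_def, map_mul, map_pow, IntermediateField.algebraMap_apply]
      ring
    rw [e]
    refine w.map_sub_lt (by rw [hUw]; exact hlt.trans_le (hmax' i))
      (w.map_sum_lt hj0.ne' fun k _ => ?_)
    rw [map_mul, map_pow, hUw]
    refine mul_lt_of_lt_of_le_one ?_ (pow_le_one' hβ k)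
    by_cases hk : P.coeff k = 0
    · simpa [hk] using hj0
    · exact (hL σ _ (P.coeff k).2 (by simpa using hk)).trans_le (hmax' k)

/-- Adding to an element `θ` of an asymptotically fixed extension an element `β` whose conjugates
have distinct residues again generates an asymptotically fixed extension, as soon as every
conjugate of `θ + β` arises by conjugating `θ` alone. -/
theorem IsAsymptoticallyFixed.adjoin_add [IsAlgClosure K Ω] (v : Valuation K Γ₀)
    {w : Valuation Ω Γ₁} [v.HasExtension w] [HenselianLocalRing v.valuationSubring]
    {L : IntermediateField K Ω} (hL : IsAsymptoticallyFixed w L) {β : Ω} (hβ : w β ≤ 1)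
    (hsep : IsSeparable K β) (hres : ∀ σ : Ω ≃ₐ[K] Ω, w (σ β - β) < 1 → σ β = β)
    (θ : L) (hconj : ∀ σ : Ω ≃ₐ[K] Ω, ∃ τ : Ω ≃ₐ[K] Ω, σ (θ + β) = τ θ + β) :
    IsAsymptoticallyFixed w K⟮(θ + β : Ω)⟯ := by
  intro σ x hx hx0
  have hint (y : Ω) : IsIntegral K y := (IsAlgClosure.isAlgebraic (R := K)).isIntegral.isIntegral y
  rw [← IntermediateField.mem_toSubalgebra, adjoin_simple_toSubalgebra_of_isAlgebraic
    (hint _).isAlgebraic, Algebra.adjoin_singleton_eq_range_aeval] at hx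
  obtain ⟨P, rfl⟩ := hx
  obtain ⟨τ, hτ⟩ := hconj σ
  -- Expanding `P (θ + X)` modulo the minimal polynomial of `β` writes `x` as a combination of the
  -- powers of `β` below its degree, with coefficients in `L`.
  set Q : Polynomial L := (P.map (algebraMap K L)).comp (X + C θ) %ₘ
    (minpoly K β).map (algebraMap K L) with hQ
  have hmon := (minpoly.monic (hint β)).map (algebraMap K L)
  have hQdeg : Q.degree < (minpoly K β).degree := by
    rw [← degree_map (minpoly K β) (algebraMap K L)]
    exact degree_modByMonic_lt _ hmon
  have heval (ρ : Ω ≃ₐ[K] Ω) : Q.eval₂ ((ρ : Ω →+* Ω).comp (algebraMap L Ω)) β =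
      aeval (ρ θ + β) P := by
    have hcomp : ((ρ : Ω →+* Ω).comp (algebraMap L Ω)).comp (algebraMap K L) =
        algebraMap K Ω := by
      ext y
      exact ρ.commutes y
    rw [hQ, eval₂_modByMonic_eq_self_of_root, eval₂_comp, eval₂_map, hcomp, eval₂_add, eval₂_X,
      eval₂_C, add_comm β, aeval_def]
    · rfl
    · rw [eval₂_map, hcomp]
      exact minpoly.aeval K β
  have hx : aeval β Q = aeval (θ + β : Ω) P := heval AlgEquiv.refl
  have hσx : σ (aeval (θ + β : Ω) P) =
      Q.eval₂ ((τ : Ω →+* Ω).comp (algebraMap L Ω)) β := by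
    rw [heval, ← hτ, ← AlgEquiv.coe_toAlgHom, ← aeval_algHom_apply]
  have hx0' : w (aeval β Q) ≠ 0 := by
    rw [w.ne_zero_iff, hx]
    exact hx0
  change w (σ (aeval (θ + β : Ω) P) - aeval (θ + β : Ω) P) < w (aeval (θ + β : Ω) P)
  rw [hσx, ← hx, aeval_def, eval₂_eq_sum_range, eval₂_eq_sum_range, ← Finset.sum_sub_distrib,
    ← eval₂_eq_sum_range, ← aeval_def]
  refine w.map_sum_lt hx0' fun k _ => ?_
  rw [← sub_mul, map_mul, map_pow]
  refine mul_lt_of_lt_of_le_one ?_ (pow_le_one' hβ k)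
  by_cases hk : Q.coeff k = 0
  · simpa [hk, zero_lt_iff] using hx0'
  · exact (hL τ _ (Q.coeff k).2 (by simpa using hk)).trans_le
      (hL.coeff_le_aeval v hβ hsep hres hQdeg k)

end Perturbation

/-! ### Roots of additive polynomials -/

section AdditivePolynomial

theorem aeval_additivePoly_map {R K A : Type*} [CommRing R] [CommRing K] [CommRing A] [Algebra R K]
    [Algebra K A] (p n : ℕ) (a : ℕ → R) (x : A) :
    aeval x ((additivePoly p n a).map (algebraMap R K)) =
      ∑ i ∈ Finset.range (n + 1), algebraMap K A (algebraMap R K (a i)) * x ^ p ^ i := by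
  simp [additivePoly, Polynomial.map_sum]

theorem aeval_additivePoly_map_add {R K A : Type*} [CommRing R] [CommRing K] [CommRing A]
    [Algebra R K] [Algebra K A] (p : ℕ) [Fact p.Prime] [CharP A p] (n : ℕ) (a : ℕ → R) (x y : A) :
    aeval (x + y) ((additivePoly p n a).map (algebraMap R K)) =
      aeval x ((additivePoly p n a).map (algebraMap R K)) +
        aeval y ((additivePoly p n a).map (algebraMap R K)) := by
  simp only [aeval_additivePoly_map, add_pow_char_pow, mul_add, Finset.sum_add_distrib]

theorem aeval_additivePoly_map_sub {R K A : Type*} [CommRing R] [CommRing K] [CommRing A]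
    [Algebra R K] [Algebra K A] (p : ℕ) [Fact p.Prime] [CharP A p] (n : ℕ) (a : ℕ → R) (x y : A) :
    aeval (x - y) ((additivePoly p n a).map (algebraMap R K)) =
      aeval x ((additivePoly p n a).map (algebraMap R K)) -
        aeval y ((additivePoly p n a).map (algebraMap R K)) := by
  simp only [aeval_additivePoly_map, sub_pow_char_pow, mul_sub, Finset.sum_sub_distrib]

theorem derivative_additivePoly {R : Type*} [CommRing R] (p : ℕ) [CharP R p] (n : ℕ) (a : ℕ → R) :
    derivative (additivePoly p n a) = C (a 0) := by
  rw [additivePoly, derivative_sum, Finset.sum_range_succ', Finset.sum_eq_zero]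
  · simp
  · intro i _
    simp [derivative_X_pow, pow_succ]

variable {K Ω Γ₀ Γ₁ : Type*} [Field K] [Field Ω] [Algebra K Ω]
  [LinearOrderedCommGroupWithZero Γ₀] [LinearOrderedCommGroupWithZero Γ₁]
  (p : ℕ) (v : Valuation K Γ₀) (n : ℕ) (a : ℕ → v.valuationSubring)

theorem derivative_additivePoly_map_sub_C [CharP K p] (b : K) :
    derivative ((additivePoly p n a).map (algebraMap v.valuationSubring K) - C b) =
      C (a 0 : K) := by
  have : CharP v.valuationSubring p :=
    (algebraMap v.valuationSubring K).charP Subtype.coe_injective p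
  rw [derivative_sub, derivative_C, sub_zero, derivative_map, derivative_additivePoly, map_C]
  rfl

theorem separable_additivePoly_map_sub_C [CharP K p] (ha₀ : v (a 0 : K) = 1) (b : K) :
    ((additivePoly p n a).map (algebraMap v.valuationSubring K) - C b).Separable := by
  rw [separable_def, derivative_additivePoly_map_sub_C]
  refine isCoprime_one_right.of_isCoprime_of_dvd_right ((isUnit_iff_dvd_one.1 ?_))
  rw [isUnit_C, isUnit_iff_ne_zero, ← v.ne_zero_iff, ha₀]
  exact one_ne_zero

theorem exists_aeval_additivePoly_eq [IsAlgClosed Ω] [CharP K p] (ha₀ : v (a 0 : K) = 1) (b : K) :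
    ∃ β : Ω, aeval β ((additivePoly p n a).map (algebraMap v.valuationSubring K)) =
      algebraMap K Ω b := by
  obtain ⟨β, hβ⟩ := IsAlgClosed.exists_aeval_eq_zero Ω
    ((additivePoly p n a).map (algebraMap v.valuationSubring K) - C b) fun hdeg => by
      have h := derivative_additivePoly_map_sub_C p v n a b
      rw [eq_C_of_degree_eq_zero hdeg, derivative_C, eq_comm, C_eq_zero] at h
      rw [h, map_zero] at ha₀
      exact zero_ne_one ha₀
  rw [map_sub, aeval_C, sub_eq_zero] at hβ
  exact ⟨β, hβ⟩

variable {v} (w : Valuation Ω Γ₁) [v.HasExtension w]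

theorem valuation_algebraMap_mul_pow_le (r : v.valuationSubring) (m : ℕ) (x : Ω) :
    w (algebraMap K Ω (algebraMap v.valuationSubring K r) * x ^ m) ≤ w x ^ m := by
  rw [map_mul, map_pow]
  exact mul_le_of_le_one_left' ((Valuation.HasExtension.val_map_le_one_iff v w _).2 r.2)

/-- The roots of an additive polynomial over the valuation ring whose linear coefficient is a unit
have distinct residues. -/
theorem eq_zero_of_aeval_additivePoly_eq_zero [Fact p.Prime] (ha₀ : v (a 0 : K) = 1) {z : Ω}
    (hz : w z < 1)
    (h : aeval z ((additivePoly p n a).map (algebraMap v.valuationSubring K)) = 0) : z = 0 := by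
  by_contra hz0
  have hp : p.Prime := Fact.out
  have hwz : 0 < w z := by simpa [zero_lt_iff] using hz0
  rw [aeval_additivePoly_map, Finset.sum_range_succ', add_comm, add_eq_zero_iff_eq_neg] at h
  have h' := congrArg w h
  rw [w.map_neg, pow_zero, pow_one, map_mul,
    (Valuation.HasExtension.val_map_eq_one_iff v w (algebraMap _ K (a 0))).2 ha₀, one_mul] at h'
  refine (w.map_sum_lt hwz.ne' fun i _ => ?_).ne h'.symm
  refine (valuation_algebraMap_mul_pow_le w _ _ _).trans_lt ?_
  exact pow_lt_self_of_lt_one₀ hwz hz (Nat.one_lt_pow i.succ_ne_zero hp.one_lt)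

theorem le_one_of_aeval_additivePoly_le_one [Fact p.Prime] (haₙ : v (a n : K) = 1) {x : Ω}
    (h : w (aeval x ((additivePoly p n a).map (algebraMap v.valuationSubring K))) ≤ 1) :
    w x ≤ 1 := by
  by_contra! hx
  have hp : p.Prime := Fact.out
  have hx0 : 0 < w x := zero_lt_one.trans hx
  have hn : w (algebraMap K Ω (algebraMap v.valuationSubring K (a n)) * x ^ p ^ n) =
      w x ^ p ^ n := by
    rw [map_mul,
      (Valuation.HasExtension.val_map_eq_one_iff v w (algebraMap _ K (a n))).2 haₙ, one_mul,
      map_pow]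
  rw [aeval_additivePoly_map, Finset.sum_range_succ, w.map_add_eq_of_lt_right, hn] at h
  · exact h.not_gt (one_lt_pow₀ hx (pow_pos hp.pos n).ne')
  · rw [hn]
    refine w.map_sum_lt (pow_pos hx0 _).ne' fun i hi => ?_
    exact (valuation_algebraMap_mul_pow_le w _ _ _).trans_lt
      (pow_lt_pow_right₀ hx (Nat.pow_lt_pow_right hp.one_lt (Finset.mem_range.1 hi)))

end AdditivePolynomial

/-! ### Maximal purely wild extensions -/

theorem theorem3p5 {p : ℕ} [Fact p.Prime] {K Ω Γ₀ Γ₁ : Type*} [Field K] [CharP K p]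
    [Field Ω] [Algebra K Ω] [IsAlgClosure K Ω]
    [LinearOrderedCommGroupWithZero Γ₀] [LinearOrderedCommGroupWithZero Γ₁]
    (v : Valuation K Γ₀) (w : Valuation Ω Γ₁) [v.HasExtension w]
    [HenselianLocalRing v.valuationSubring]
    (θ : Ω) (hθ : IsMinimalPurelyWildSubext p v w K⟮θ⟯)
    (n : ℕ) (a : ℕ → v.valuationSubring) (c : K)
    (hmin : Associated (minpoly K θ)
      ((additivePoly p n a).map (algebraMap v.valuationSubring K) - C c))
    (ha₀ : v (a 0 : K) = 1) (haₙ : v (a n : K) = 1)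
    (hclosed : ¬ IsPolyClosed
      ((additivePoly p n a).map (IsLocalRing.residue v.valuationSubring))) :
    ∃ W₁ W₂ : IntermediateField K Ω,
      IsMaximalPurelyWildSubext p v w W₁ ∧ IsMaximalPurelyWildSubext p v w W₂ ∧
        IsEmpty (W₁ ≃ₐ[K] W₂) := by
  have : IsAlgClosed Ω := IsAlgClosure.isAlgClosed K
  have : Algebra.IsAlgebraic K Ω := IsAlgClosure.isAlgebraic
  have : CharP Ω p := charP_of_injective_algebraMap (algebraMap K Ω).injective p
  set F := (additivePoly p n a).map (algebraMap v.valuationSubring K) with hF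
  have hFadd (x y : Ω) : aeval (x + y) F = aeval x F + aeval y F :=
    aeval_additivePoly_map_add p n a x y
  have hFsub (x y : Ω) : aeval (x - y) F = aeval x F - aeval y F :=
    aeval_additivePoly_map_sub p n a x y
  have hFσ (σ : Ω ≃ₐ[K] Ω) (x : Ω) : aeval (σ x) F = σ (aeval x F) :=
    aeval_algHom_apply (σ : Ω →ₐ[K] Ω) x F
  have hFθ : aeval θ F = algebraMap K Ω c := by
    have := (minpoly.dvd_iff (A := K) (x := θ)).1 hmin.dvd
    rwa [map_sub, aeval_C, sub_eq_zero] at this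
  obtain ⟨d, hd⟩ := not_forall.1 hclosed
  obtain ⟨b, rfl⟩ := IsLocalRing.residue_surjective d
  obtain ⟨β, hβ⟩ := exists_aeval_additivePoly_eq (Ω := Ω) p v n a ha₀ (b : K)
  -- The relevant properties of `β` hold for every root of `𝔄(X) - b`.
  have hint {y : Ω} (hy : aeval y F = algebraMap K Ω b) : w y ≤ 1 :=
    le_one_of_aeval_additivePoly_le_one p n a w haₙ
      (by rw [← hF, hy]; exact (Valuation.HasExtension.val_map_le_one_iff v w _).2 b.2)
  have hsep {y : Ω} (hy : aeval y F = algebraMap K Ω b) : IsSeparable K y :=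
    (separable_additivePoly_map_sub_C p v n a ha₀ (b : K)).of_dvd
      (minpoly.dvd K y (by rw [map_sub, ← hF, hy, aeval_C, sub_self]))
  have hres {y : Ω} (hy : aeval y F = algebraMap K Ω b) (σ : Ω ≃ₐ[K] Ω)
      (hσ : w (σ y - y) < 1) : σ y = y :=
    sub_eq_zero.1 (eq_zero_of_aeval_additivePoly_eq_zero p n a w ha₀ hσ
      (by rw [← hF, hFsub, hFσ, hy, σ.commutes, sub_self]))
  have hfix := (isPurelyWildSubext_iff_isAsymptoticallyFixed p v w _).1 hθ.1
  have hfix' : IsAsymptoticallyFixed w K⟮(θ + β : Ω)⟯ :=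
    hfix.adjoin_add v (hint hβ) (hsep hβ) (hres hβ) ⟨θ, mem_adjoin_simple_self K θ⟩ fun σ => by
      -- `σ (θ + β) - β` is a root of `𝔄(X) - c`, hence a conjugate of `θ`.
      obtain ⟨τ, hτ⟩ := minpoly.exists_algEquiv_of_root' (K := K) (x := σ (θ + β) - β) (y := θ)
        (Algebra.IsAlgebraic.isAlgebraic θ) (by
          refine aeval_eq_zero_of_dvd_aeval_eq_zero hmin.dvd' ?_
          rw [map_sub, aeval_C, hFsub, hFσ, hFadd, hFθ, hβ, map_add, σ.commutes, σ.commutes]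
          ring)
      exact ⟨τ, by rw [hτ, sub_add_cancel]⟩
  obtain ⟨W₁, hW₁, hmax₁⟩ := exists_isMaximalPurelyWildSubext_ge p v w hθ.1
  obtain ⟨W₂, hW₂, hmax₂⟩ := exists_isMaximalPurelyWildSubext_ge p v w
    ((isPurelyWildSubext_iff_isAsymptoticallyFixed p v w _).2 hfix')
  refine ⟨W₁, W₂, hmax₁, hmax₂, ⟨fun e => hd ?_⟩⟩
  -- An isomorphism provides roots of both `𝔄(X) - c` and `𝔄(X) - (c + b)` in `W₂`, hence a root
  -- `y` of `𝔄(X) - b`, and such a root has to lie in `K`.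
  obtain ⟨θ', hθ'⟩ : ∃ θ' ∈ W₂, aeval θ' F = algebraMap K Ω c :=
    ⟨e ⟨θ, hW₁ (mem_adjoin_simple_self K θ)⟩, SetLike.coe_mem _, by
      have h := aeval_algHom_apply ((W₂.val.comp (e : W₁ →ₐ[K] W₂)))
        (⟨θ, hW₁ (mem_adjoin_simple_self K θ)⟩ : W₁) F
      have h₁ : aeval (⟨θ, hW₁ (mem_adjoin_simple_self K θ)⟩ : W₁) F = algebraMap K W₁ c := by
        refine (algebraMap W₁ Ω).injective ?_
        rw [← aeval_algebraMap_apply, ← IsScalarTower.algebraMap_apply]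
        exact hFθ
      rw [h₁, AlgHom.commutes] at h
      exact h⟩
  set y := θ + β - θ' with hy
  have hyW : y ∈ W₂ := sub_mem (hW₂ (mem_adjoin_simple_self K _)) hθ'.1
  have hFy : aeval y F = algebraMap K Ω b := by
    rw [hy, hFsub, hFadd, hFθ, hθ'.2, hF, hβ, add_sub_cancel_left]
  have hfixW := (isPurelyWildSubext_iff_isAsymptoticallyFixed p v w _).1 hmax₂.prop
  obtain ⟨z, hz⟩ := mem_range_algebraMap_of_conj_lt v w (hsep hFy) fun σ hσ =>
    absurd (hres hFy σ (by
      rcases eq_or_ne y 0 with h0 | h0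
      · simp [h0]
      · exact (hfixW σ y hyW h0).trans_le (hint hFy))) hσ
  have hvz : v z ≤ 1 := by
    rw [← Valuation.HasExtension.val_map_le_one_iff v w, hz]
    exact hint hFy
  refine ⟨IsLocalRing.residue v.valuationSubring ⟨z, hvz⟩, ?_⟩
  have hzb : (additivePoly p n a).eval ⟨z, hvz⟩ = b := by
    apply Subtype.coe_injective
    apply (algebraMap K Ω).injective
    rw [← hFy, ← hz, aeval_algebraMap_apply, hF, aeval_map_algebraMap]
    congr 1
    exact (aeval_algebraMap_apply_eq_algebraMap_eval (A := K)
      (⟨z, hvz⟩ : v.valuationSubring) _).symm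
  change eval _ _ = _
  rw [eval_map, eval₂_at_apply, hzb]
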